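/- Let $n,k\ge 1$ be integers and $s\in(0,1)$. Let $\omega\subset\mathbb R^n$ be a bounded open set (for instance a bounded Lipschitz domain), let $B\subset\mathbb R^k$ be a bounded, open and convex neighbourhood of the origin, and put $B_\ell=\ell B$ for $\ell>0$ and $\Omega=\omega\times B\subset\mathbb R^{n+k}$. For $u\in L^2(\mathbb R^d)$ let $$\mathcal E^s_d(u)=\langle(-\Delta)^su,u\rangle=\int_{\mathbb R^d}|\xi|^{2s}|\mathcal F_d[u](\xi)|^2\,d\xi\in[0,\infty],$$ where $\mathcal F_d$ is the unitary Fourier transform on $L^2(\mathbb R^d)$, and let $\widetilde H^s(\Omega)$ be the space of all real-valued $v\in L^2(\mathbb R^{n+k})$ with $\mathcal E^s_{n+k}(v)<\infty$ and $v=0$ a.e. on $\mathbb R^{n+k}\setminus\overline\Omega$, with the Hilbert norm $\|v\|^2=\mathcal E^s_{n+k}(v)+\|v\|^2_{L^2(\mathbb R^{n+k})}$. For $\ell>0$ and $v\in\widetilde H^s(\Omega)$ define the rescaled energy $$\mathscr E_\ell(v)=\frac1{|B_\ell|}\,\mathcal E^s_{n+k}(\breve v_\ell),\qquad \breve v_\ell(x,t)=v\Big(x,\frac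 t\ell\Big),\quad (x,t)\in\mathbb R^n\times\mathbb R^k.$$ Then, along every sequence $\ell_h>0$ with $\ell_h\to\infty$, the functionals $\mathscr E_{\ell_h}$ $\Gamma$-converge (sequentially), with respect to the weak topology of $\widetilde H^s(\Omega)$, to the functional $$\mathscr E_\infty(v)=\frac1{|B|}\int_{B}\mathcal E^s_n(v(\cdot,t))\,dt .$$ That is, for every $v\in\widetilde H^s(\Omega)$: (i) $\mathscr E_\infty(v)\le\liminf_{h\to\infty}\mathscr E_{\ell_h}(v_h)$ for every sequence $v_h\in\widetilde H^s(\Omega)$ that converges weakly to $v$; (ii) there is a sequence $\overline v_h\in\widetilde H^s(\Omega)$ that converges weakly to $v$ and satisfies $\limsup_{h\to\infty}\mathscr E_{\ell_h}(\overline v_h)\le\mathscr E_\infty(v)$. -/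

import Mathlib

open MeasureTheory Filter Topology Set FourierTransform
open scoped ENNReal

noncomputable section

namespace FracCylinder

section Energy

variable {V : Type*} [NormedAddCommGroup V] [InnerProductSpace ℝ V] [FiniteDimensional ℝ V]
  [MeasurableSpace V] [BorelSpace V]

/-- The `L²` Fourier transform `û` of a real-valued `u ∈ L²(V)`, in Mathlib's normalization
`û ξ = ∫ exp (-2πi⟨z, ξ⟩) u z dz`. -/
def fourierL2 (u : Lp ℝ 2 (volume : Measure V)) : Lp ℂ 2 (volume : Measure V) :=
  𝓕 (Complex.ofRealCLM.compLp u)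

/-- The quadratic form `⟨(-Δ)^s u, u⟩` of the fractional Laplacian on `L²(V)`, with values in
`[0, ∞]`. With the unitary Fourier transform in the variable `η = 2πξ` this is
`∫ |η|^{2s} |F[u](η)|² dη`. -/
def energyL2 (s : ℝ) (u : Lp ℝ 2 (volume : Measure V)) : ℝ≥0∞ :=
  ∫⁻ ξ : V, ENNReal.ofReal ((2 * Real.pi * ‖ξ‖) ^ (2 * s)) * ‖fourierL2 u ξ‖ₑ ^ 2

open Classical in
/-- The same quadratic form on functions; it is `∞` off `L²(V)`. -/
def energy (s : ℝ) (u : V → ℝ) : ℝ≥0∞ :=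
  if h : MemLp u 2 (volume : Measure V) then energyL2 s (h.toLp u) else ⊤

theorem fourierL2_add (u v : Lp ℝ 2 (volume : Measure V)) :
    fourierL2 (u + v) = fourierL2 u + fourierL2 v := by
  unfold fourierL2
  rw [← FourierTransform.fourier_add]
  exact congrArg _ (map_add (Complex.ofRealCLM.compLpL 2 (volume : Measure V)) u v)

theorem fourierL2_smul (c : ℝ) (u : Lp ℝ 2 (volume : Measure V)) :
    fourierL2 (c • u) = (c : ℂ) • fourierL2 u := by
  unfold fourierL2
  rw [← FourierTransform.fourier_smul]
  exact congrArg _ (map_smul (Complex.ofRealCLM.compLpL 2 (volume : Measure V)) c u)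

/-- The Fourier transform of `(-Δ)^{s/2} u`. -/
def weighted (s : ℝ) (u : Lp ℝ 2 (volume : Measure V)) (ξ : V) : ℂ :=
  (((2 * Real.pi * ‖ξ‖) ^ s : ℝ) : ℂ) * fourierL2 u ξ

theorem aestronglyMeasurable_weighted (s : ℝ) (u : Lp ℝ 2 (volume : Measure V)) :
    AEStronglyMeasurable (weighted s u) volume := by
  refine AEStronglyMeasurable.mul ?_ (Lp.aestronglyMeasurable _)
  have : Measurable fun ξ : V => (((2 * Real.pi * ‖ξ‖) ^ s : ℝ) : ℂ) := by fun_prop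
  exact this.aestronglyMeasurable

theorem energyL2_eq (s : ℝ) (u : Lp ℝ 2 (volume : Measure V)) :
    energyL2 s u = eLpNorm (weighted s u) 2 volume ^ 2 := by
  rw [eLpNorm_eq_lintegral_rpow_enorm_toReal (by norm_num) (by norm_num), ← ENNReal.rpow_natCast,
    ← ENNReal.rpow_mul]
  norm_num
  unfold energyL2
  refine lintegral_congr fun ξ => ?_
  have h0 : 0 ≤ 2 * Real.pi * ‖ξ‖ := by positivity
  unfold weighted
  rw [enorm_mul, mul_pow]
  congr 1
  rw [← ofReal_norm, Complex.norm_real, Real.norm_of_nonneg (Real.rpow_nonneg h0 _),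
    ← ENNReal.ofReal_pow (Real.rpow_nonneg h0 _), ← Real.rpow_mul_natCast h0]
  congr 2
  push_cast
  ring

theorem memLp_weighted_iff (s : ℝ) (u : Lp ℝ 2 (volume : Measure V)) :
    MemLp (weighted s u) 2 volume ↔ energyL2 s u < ⊤ := by
  rw [energyL2_eq]
  simp [MemLp, aestronglyMeasurable_weighted]

theorem weighted_add (s : ℝ) (u v : Lp ℝ 2 (volume : Measure V)) :
    weighted s (u + v) =ᵐ[volume] weighted s u + weighted s v := by
  filter_upwards [Lp.coeFn_add (fourierL2 u) (fourierL2 v)] with ξ h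
  simp only [weighted, fourierL2_add, h, Pi.add_apply, mul_add]

theorem weighted_smul (s c : ℝ) (u : Lp ℝ 2 (volume : Measure V)) :
    weighted s (c • u) =ᵐ[volume] c • weighted s u := by
  filter_upwards [Lp.coeFn_smul (c : ℂ) (fourierL2 u)] with ξ h
  simp only [weighted, fourierL2_smul, h, Pi.smul_apply, smul_eq_mul, Complex.real_smul]
  ring

/-- `{u ∈ Hˢ(V) | u = 0 a.e. on the complement of the closure of U}`, as a linear subspace of
`L²(V)`; here `u ∈ Hˢ(V)` means that `u ∈ L²(V)` and `(-Δ)^{s/2} u ∈ L²(V)`. -/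
def htildeSubmodule (s : ℝ) (U : Set V) : Submodule ℝ (Lp ℝ 2 (volume : Measure V)) where
  carrier := {u | energyL2 s u < ⊤ ∧ ∀ᵐ z : V, z ∉ closure U → u z = 0}
  zero_mem' := by
    refine ⟨?_, ?_⟩
    · rw [← memLp_weighted_iff]
      have h : weighted s (0 : Lp ℝ 2 (volume : Measure V)) =ᵐ[volume] (0 : V → ℂ) := by
        have := weighted_smul s 0 (0 : Lp ℝ 2 (volume : Measure V))
        simpa using this
      exact (memLp_congr_ae h).2 MemLp.zero
    · filter_upwards [Lp.coeFn_zero ℝ 2 (volume : Measure V)] with z hz _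
      exact hz
  add_mem' := by
    rintro u v ⟨hu, hu'⟩ ⟨hv, hv'⟩
    refine ⟨?_, ?_⟩
    · rw [← memLp_weighted_iff] at *
      exact (memLp_congr_ae (weighted_add s u v)).2 (hu.add hv)
    · filter_upwards [hu', hv', Lp.coeFn_add u v] with z h1 h2 h3 hz
      exact h3.trans (by simp [h1 hz, h2 hz])
  smul_mem' := by
    rintro c u ⟨hu, hu'⟩
    refine ⟨?_, ?_⟩
    · rw [← memLp_weighted_iff] at *
      exact (memLp_congr_ae (weighted_smul s c u)).2 (hu.const_smul c)
    · filter_upwards [hu', Lp.coeFn_smul c u] with z h1 h3 hz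
      exact h3.trans (by simp [h1 hz])

/-- The space `H̃ˢ(U)`. It is a type of its own, because its norm is the one of `Hˢ(V)` and not the
one of `L²(V)`. -/
def Htilde (s : ℝ) (U : Set V) : Type _ := htildeSubmodule s U

variable {s : ℝ} {U : Set V}

instance : AddCommGroup (Htilde s U) := inferInstanceAs (AddCommGroup (htildeSubmodule s U))

instance : Module ℝ (Htilde s U) := inferInstanceAs (Module ℝ (htildeSubmodule s U))

/-- The element of `L²(V)` underlying an element of `H̃ˢ(U)`. -/
def Htilde.toL2 (u : Htilde s U) : Lp ℝ 2 (volume : Measure V) :=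
  Subtype.val (p := fun u => u ∈ htildeSubmodule s U) u

/-- The linear embedding `u ↦ (u, F[(-Δ)^{s/2} u])` of `H̃ˢ(U)` into `L²(V) × L²(V; ℂ)`. -/
def Htilde.embed (s : ℝ) (U : Set V) : Htilde s U →ₗ[ℝ]
    WithLp 2 (Lp ℝ 2 (volume : Measure V) × Lp ℂ 2 (volume : Measure V)) where
  toFun u := WithLp.toLp 2 (u.toL2, ((memLp_weighted_iff s u.toL2).2 u.2.1).toLp _)
  map_add' u v := by
    have h : ((memLp_weighted_iff s (u + v).toL2).2 (u + v).2.1).toLp _ =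
        ((memLp_weighted_iff s u.toL2).2 u.2.1).toLp _ +
        ((memLp_weighted_iff s v.toL2).2 v.2.1).toLp _ := by
      rw [← MemLp.toLp_add]
      exact MemLp.toLp_congr _ _ (weighted_add s u.toL2 v.toL2)
    rw [h]
    rfl
  map_smul' c u := by
    have h : ((memLp_weighted_iff s (c • u).toL2).2 (c • u).2.1).toLp _ =
        c • ((memLp_weighted_iff s u.toL2).2 u.2.1).toLp _ := by
      rw [← MemLp.toLp_const_smul]
      exact MemLp.toLp_congr _ _ (weighted_smul s c u.toL2)
    rw [h]
    rfl

theorem Htilde.embed_injective : Function.Injective (Htilde.embed s U) := fun _ _ h =>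
  Subtype.ext (congrArg (fun p => (WithLp.ofLp p).1) h)

/-- The norm of `Hˢ(V)`; see `Htilde.norm_sq`. -/
instance : NormedAddCommGroup (Htilde s U) :=
  NormedAddCommGroup.induced _ _ (Htilde.embed s U) Htilde.embed_injective

instance : NormedSpace ℝ (Htilde s U) := NormedSpace.induced ℝ _ _ (Htilde.embed s U)

theorem Htilde.norm_sq (u : Htilde s U) :
    ‖u‖ ^ 2 = (energyL2 s u.toL2).toReal + ‖u.toL2‖ ^ 2 := by
  change ‖Htilde.embed s U u‖ ^ 2 = _
  rw [WithLp.prod_norm_sq_eq_of_L2, add_comm, energyL2_eq]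
  simp [Htilde.embed, Lp.norm_toLp]

end Energy

/-- De Giorgi's sequential `Γ`-convergence of `J h : X → [-∞, ∞]` to `Jlim` in the topology
of `X`. -/
def IsGammaLimit {X : Type*} [TopologicalSpace X] (J : ℕ → X → EReal) (Jlim : X → EReal) : Prop :=
  (∀ (v : X) (w : ℕ → X), Tendsto w atTop (𝓝 v) →
      Jlim v ≤ liminf (fun h => J h (w h)) atTop) ∧
  (∀ v : X, ∃ w : ℕ → X, Tendsto w atTop (𝓝 v) ∧
      limsup (fun h => J h (w h)) atTop ≤ Jlim v)

section Cylinder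

variable {n k : ℕ}

/-- `ℝⁿ⁺ᵏ = ℝⁿ × ℝᵏ` with its Euclidean structure. -/
abbrev Space (n k : ℕ) : Type :=
  WithLp 2 (EuclideanSpace ℝ (Fin n) × EuclideanSpace ℝ (Fin k))

/-- The cylinder `ω × B`. -/
def cylinder (ω : Set (EuclideanSpace ℝ (Fin n))) (B : Set (EuclideanSpace ℝ (Fin k))) :
    Set (Space n k) :=
  {z | z.fst ∈ ω ∧ z.snd ∈ B}

/-- `(x, t) ↦ v (x, t / ℓ)`. -/
def stretch (ℓ : ℝ) (v : Space n k → ℝ) : Space n k → ℝ :=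
  fun z => v (WithLp.toLp 2 (z.fst, ℓ⁻¹ • z.snd))

open scoped Pointwise in
/-- The rescaled energy `|ℓB|⁻¹ ⟨(-Δ)^s v(·, ·/ℓ), v(·, ·/ℓ)⟩`. -/
def rescaledEnergy (s : ℝ) (B : Set (EuclideanSpace ℝ (Fin k))) (ℓ : ℝ) (v : Space n k → ℝ) :
    ℝ≥0∞ :=
  (volume (ℓ • B))⁻¹ * energy s (stretch ℓ v)

/-- The average over `t ∈ B` of the `n`-dimensional energies of the slices `v(·, t)`. -/
def averagedSliceEnergy (s : ℝ) (B : Set (EuclideanSpace ℝ (Fin k))) (v : Space n k → ℝ) : ℝ≥0∞ :=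
  ⨍⁻ t in B, energy s (fun x : EuclideanSpace ℝ (Fin n) => v (WithLp.toLp 2 (x, t))) ∂volume

end Cylinder

end FracCylinder

end

/-! Elements of `H̃ˢ(ω × B)` vanish off a bounded set, so they lie in `L¹ ∩ L²` and their transform
`û(ξ, τ)` is a Fourier integral. Both energies become weighted integrals of the same density `|û|²`.
Stretching `t` by `ℓ` contracts `τ` by `ℓ`, and `|ℓB| = ℓᵏ|B|` absorbs the Jacobian, so `E_ℓ(u) =
|B|⁻¹ ∫ (2π|(ξ, τ/ℓ)|)^{2s} |û|²` (`rescaledEnergy_eq`). Plancherel in `t` gives `E_∞(u) = |B|⁻¹ ∫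
(2π|ξ|)^{2s} |û|²` (`averagedSliceEnergy_eq`).

Since `|ξ| ≤ |(ξ, τ/ℓ)|`, one has `E_∞ ≤ E_ℓ` for every `ℓ`. As `E_∞` is, up to the factor `|B|⁻¹`,
the squared norm of a bounded linear map, it is weakly lower semicontinuous
(`averagedSliceEnergy_le_liminf`); together these give the liminf inequality. For fixed `u`,
dominated convergence gives `E_ℓ(u) → E_∞(u)` (`tendsto_rescaledEnergy`), so constant sequences are
recovery sequences. -/

namespace FracCylinder
-- The Fourier integral on `L¹ ∩ L²`
section Fourier

variable {V : Type*} [NormedAddCommGroup V] [InnerProductSpace ℝ V] [FiniteDimensional ℝ V]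
  [MeasurableSpace V] [BorelSpace V]

theorem continuous_fourier {f : V → ℂ} (hf : Integrable f) : Continuous (𝓕 f) :=
  VectorFourier.fourierIntegral_continuous Real.continuous_fourierChar
    (by exact continuous_inner) hf

/-- On `L¹ ∩ L²`, the `L²` Fourier transform is the Fourier integral. -/
theorem fourier_Lp_ae_eq (f : Lp ℂ 2 (volume : Measure V)) (hf : Integrable f) :
    (𝓕 f : Lp ℂ 2 (volume : Measure V)) =ᵐ[volume] 𝓕 (f : V → ℂ) := by
  refine ae_eq_of_integral_contDiff_smul_eq
    ((Lp.memLp _).locallyIntegrable (by norm_num)) (continuous_fourier hf).locallyIntegrable ?_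
  intro g hg hgc
  have hg₁ : HasCompactSupport (Complex.ofRealCLM ∘ g) := hgc.comp_left rfl
  have hg₂ : ContDiff ℝ (⊤ : ℕ∞) (Complex.ofRealCLM ∘ g) := by fun_prop
  -- Both transforms move onto the test function by duality: `key` for the `L²` transform, as a
  -- tempered distribution, and `h2` for the Fourier integral, by Fubini.
  have key := congrArg (fun T => T (hg₁.toSchwartzMap hg₂)) (Lp.fourier_toTemperedDistribution_eq f)
  simp only [TemperedDistribution.fourier_apply, Lp.toTemperedDistribution_apply] at key
  have h2 := VectorFourier.integral_fourierIntegral_smul_eq_flip (L := innerₗ V)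
    (μ := volume) (ν := volume) (f := hg₁.toSchwartzMap hg₂) (g := f)
    Real.continuous_fourierChar continuous_inner (SchwartzMap.integrable _) hf
  rw [flip_innerₗ] at h2
  calc ∫ x, g x • (𝓕 f : Lp ℂ 2 (volume : Measure V)) x
      = ∫ x, (hg₁.toSchwartzMap hg₂) x • (𝓕 f : Lp ℂ 2 (volume : Measure V)) x := by
        refine integral_congr_ae (.of_forall fun x => ?_)
        simp
    _ = ∫ x, (𝓕 (hg₁.toSchwartzMap hg₂)) x • f x := key.symm
    _ = ∫ x, (hg₁.toSchwartzMap hg₂) x • 𝓕 (f : V → ℂ) x := h2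
    _ = _ := by
        refine integral_congr_ae (.of_forall fun x => ?_)
        simp

theorem fourier_congr_ae {f g : V → ℂ} (h : f =ᵐ[volume] g) : 𝓕 f = 𝓕 g := by
  ext ξ
  simp only [Real.fourier_eq]
  refine integral_congr_ae ?_
  filter_upwards [h] with x hx
  rw [hx]

theorem fourier_toLp_ae_eq {f : V → ℂ} (hf : Integrable f) (hf2 : MemLp f 2) :
    (𝓕 (hf2.toLp f) : Lp ℂ 2 (volume : Measure V)) =ᵐ[volume] 𝓕 f := by
  have h := fourier_Lp_ae_eq (hf2.toLp f) ((integrable_congr hf2.coeFn_toLp).2 hf)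
  rwa [fourier_congr_ae hf2.coeFn_toLp] at h

theorem lintegral_enorm_sq_eq_eLpNorm_sq {α E : Type*} [MeasurableSpace α] {μ : Measure α}
    [NormedAddCommGroup E] (f : α → E) :
    ∫⁻ x, ‖f x‖ₑ ^ 2 ∂μ = eLpNorm f 2 μ ^ 2 := by
  rw [eLpNorm_eq_lintegral_rpow_enorm_toReal (by norm_num) (by norm_num), ← ENNReal.rpow_natCast,
    ← ENNReal.rpow_mul]
  norm_num

/-- **Plancherel's theorem** for the Fourier integral on `L¹ ∩ L²`. -/
theorem lintegral_enorm_sq_fourier {f : V → ℂ} (hf : Integrable f) (hf2 : MemLp f 2) :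
    ∫⁻ ξ, ‖𝓕 f ξ‖ₑ ^ 2 = ∫⁻ x, ‖f x‖ₑ ^ 2 := by
  rw [lintegral_enorm_sq_eq_eLpNorm_sq, lintegral_enorm_sq_eq_eLpNorm_sq,
    ← eLpNorm_congr_ae (fourier_toLp_ae_eq hf hf2), ← Lp.enorm_def, ← eLpNorm_congr_ae hf2.coeFn_toLp,
    ← Lp.enorm_def, ← ofReal_norm, Lp.norm_fourier_eq, ofReal_norm]

theorem fourierL2_ae_eq (u : Lp ℝ 2 (volume : Measure V)) (hu : Integrable u) :
    fourierL2 u =ᵐ[volume] 𝓕 (fun x => (u x : ℂ)) := by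
  have h : (Complex.ofRealCLM.compLp u : V → ℂ) =ᵐ[volume] fun x => (u x : ℂ) :=
    Complex.ofRealCLM.coeFn_compLp u
  have := fourier_Lp_ae_eq (Complex.ofRealCLM.compLp u) ((integrable_congr h).2 hu.ofReal)
  rwa [fourier_congr_ae h] at this

theorem energy_eq_lintegral_fourier (s : ℝ) {u : V → ℝ} (hu : Integrable u) (hu2 : MemLp u 2) :
    energy s u = ∫⁻ ξ : V, ENNReal.ofReal ((2 * Real.pi * ‖ξ‖) ^ (2 * s)) *
      ‖𝓕 (fun x => (u x : ℂ)) ξ‖ₑ ^ 2 := by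
  rw [energy, dif_pos hu2, energyL2]
  have h1 := fourierL2_ae_eq (hu2.toLp u) ((integrable_congr hu2.coeFn_toLp).2 hu)
  have h2 : (fun x => (hu2.toLp u x : ℂ)) =ᵐ[volume] fun x => (u x : ℂ) := by
    filter_upwards [hu2.coeFn_toLp] with x hx
    rw [hx]
  rw [fourier_congr_ae h2] at h1
  refine lintegral_congr_ae ?_
  filter_upwards [h1] with ξ hξ
  rw [hξ]

end Fourier

/-! ### Partial Fourier transforms on a product -/

section Slices

variable {X T : Type*} [NormedAddCommGroup X] [InnerProductSpace ℝ X] [FiniteDimensional ℝ X]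
  [MeasurableSpace X] [BorelSpace X] [NormedAddCommGroup T] [InnerProductSpace ℝ T]
  [FiniteDimensional ℝ T] [MeasurableSpace T] [BorelSpace T]

/-- The Fourier transform of `F` in the first variable. -/
noncomputable def fourierFst (F : X × T → ℂ) (ξ : X) (t : T) : ℂ := 𝓕 (fun x => F (x, t)) ξ

theorem stronglyMeasurable_fourierFst {F : X × T → ℂ} (hF : StronglyMeasurable F) :
    StronglyMeasurable (Function.uncurry (fourierFst F)) := by
  have h : StronglyMeasurable fun p : (X × T) × X =>
      Real.fourierChar (-inner ℝ p.2 p.1.1) • F (p.2, p.1.2) := by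
    have h1 : Continuous fun p : (X × T) × X => (Real.fourierChar (-inner ℝ p.2 p.1.1) : ℂ) := by
      have := Real.continuous_fourierChar
      fun_prop
    have h2 : StronglyMeasurable fun p : (X × T) × X => F (p.2, p.1.2) :=
      hF.comp_measurable (by fun_prop)
    exact h1.stronglyMeasurable.mul h2
  exact h.integral_prod_right

theorem integrable_fourierChar_smul_prod {F : X × T → ℂ} (hF : Integrable F)
    (ξ : X) : Integrable fun p : X × T => Real.fourierChar (-inner ℝ p.1 ξ) • F p := by
  have h1 : Continuous fun p : X × T => (Real.fourierChar (-inner ℝ p.1 ξ) : ℂ) := by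
    have := Real.continuous_fourierChar
    fun_prop
  exact (hF.bdd_mul (c := 1) h1.aestronglyMeasurable (.of_forall fun p => (Circle.norm_coe _).le))

theorem integrable_fourierFst {F : X × T → ℂ} (hF : Integrable F) (ξ : X) :
    Integrable (fourierFst F ξ) :=
  (integrable_fourierChar_smul_prod hF ξ).integral_prod_right

/-- The inner product of the `L²` product is a sum, so the character factors and Fubini applies. -/
theorem fourier_toLp_eq_fourier_fourierFst {F : X × T → ℂ} (hF : Integrable F) (ξ : X) (τ : T) :
    𝓕 (fun z : WithLp 2 (X × T) => F (WithLp.ofLp z)) (WithLp.toLp 2 (ξ, τ)) =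
      𝓕 (fourierFst F ξ) τ := by
  have h1 : Integrable fun p : X × T =>
      Real.fourierChar (-inner ℝ p.2 τ) • Real.fourierChar (-inner ℝ p.1 ξ) • F p := by
    have h1 : Continuous fun p : X × T => (Real.fourierChar (-inner ℝ p.2 τ) : ℂ) := by
      have := Real.continuous_fourierChar
      fun_prop
    exact ((integrable_fourierChar_smul_prod hF ξ).bdd_mul (c := 1) h1.aestronglyMeasurable
      (.of_forall fun p => (Circle.norm_coe _).le))
  calc 𝓕 (fun z : WithLp 2 (X × T) => F (WithLp.ofLp z)) (WithLp.toLp 2 (ξ, τ))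
      = ∫ z : WithLp 2 (X × T), (fun p : X × T =>
          Real.fourierChar (-inner ℝ p.2 τ) • Real.fourierChar (-inner ℝ p.1 ξ) • F p)
            (WithLp.ofLp z) := by
        rw [Real.fourier_eq]
        refine integral_congr_ae (.of_forall fun z => ?_)
        simp only [WithLp.prod_inner_apply, neg_add_rev, AddChar.map_add_eq_mul, mul_smul]
    _ = ∫ p : X × T, Real.fourierChar (-inner ℝ p.2 τ) • Real.fourierChar (-inner ℝ p.1 ξ) • F p :=
        (WithLp.volume_preserving_ofLp X T).integral_comp
          (MeasurableEquiv.toLp 2 (X × T)).symm.measurableEmbedding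
          (fun p : X × T =>
          Real.fourierChar (-inner ℝ p.2 τ) • Real.fourierChar (-inner ℝ p.1 ξ) • F p)
    _ = ∫ t, ∫ x, Real.fourierChar (-inner ℝ t τ) • Real.fourierChar (-inner ℝ x ξ) • F (x, t) := by
        rw [Measure.volume_eq_prod, integral_prod_symm _ h1]
    _ = 𝓕 (fourierFst F ξ) τ := by
        rw [Real.fourier_eq]
        refine integral_congr_ae (.of_forall fun t => ?_)
        simp only [fourierFst, Real.fourier_eq, Circle.smul_def]
        rw [integral_smul]

theorem lintegral_lintegral_toLp {g : WithLp 2 (X × T) → ℝ≥0∞} (hg : Measurable g) :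
    ∫⁻ ξ, ∫⁻ τ, g (WithLp.toLp 2 (ξ, τ)) = ∫⁻ ζ, g ζ := by
  have h : Measurable fun p : X × T => g (WithLp.toLp 2 p) :=
    hg.comp (WithLp.volume_preserving_toLp X T).measurable
  rw [← (WithLp.volume_preserving_toLp X T).lintegral_comp hg, Measure.volume_eq_prod,
    lintegral_prod _ h.aemeasurable]

theorem memLp_two_of_lintegral_lt_top {α E : Type*} [MeasurableSpace α] {μ : Measure α}
    [NormedAddCommGroup E] {f : α → E} (hf : AEStronglyMeasurable f μ)
    (h : ∫⁻ x, ‖f x‖ₑ ^ 2 ∂μ < ⊤) : MemLp f 2 μ := by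
  refine ⟨hf, ?_⟩
  rw [lintegral_enorm_sq_eq_eLpNorm_sq] at h
  by_contra h'
  simp only [not_lt, top_le_iff] at h'
  simp [h'] at h

theorem ae_memLp_slice {E : Type*} [NormedAddCommGroup E] {F : X × T → E}
    (hFm : StronglyMeasurable F) (hF2 : MemLp F 2) :
    ∀ᵐ t : T, MemLp (fun x => F (x, t)) 2 := by
  have hm : Measurable fun p : X × T => ‖F p‖ₑ ^ 2 := hFm.enorm.pow_const 2
  have hFfin : ∫⁻ p, ‖F p‖ₑ ^ 2 < ⊤ := by
    rw [lintegral_enorm_sq_eq_eLpNorm_sq]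
    exact ENNReal.pow_lt_top hF2.eLpNorm_lt_top
  rw [Measure.volume_eq_prod, lintegral_prod_symm' _ hm] at hFfin
  filter_upwards [ae_lt_top (Measurable.lintegral_prod_left' hm) hFfin.ne] with t ht
  exact memLp_two_of_lintegral_lt_top
    (hFm.comp_measurable (by fun_prop)).aestronglyMeasurable ht

theorem lintegral_slices_swap {F : X × T → ℂ} (hFm : StronglyMeasurable F)
    {w : X → ℝ≥0∞} (hw : Measurable w) :
    ∫⁻ t, ∫⁻ ξ, w ξ * ‖fourierFst F ξ t‖ₑ ^ 2 = ∫⁻ ξ, ∫⁻ t, w ξ * ‖fourierFst F ξ t‖ₑ ^ 2 := by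
  have h : Measurable fun p : T × X => w p.2 * ‖fourierFst F p.2 p.1‖ₑ ^ 2 :=
    (hw.comp measurable_snd).mul
      (((stronglyMeasurable_fourierFst hFm).measurable.comp measurable_swap).enorm.pow_const 2)
  exact lintegral_lintegral_swap (f := fun t ξ => w ξ * ‖fourierFst F ξ t‖ₑ ^ 2) h.aemeasurable

/-- Plancherel in `x` on almost every slice, then Tonelli. The resulting finiteness is what makes
Plancherel in `t` available for almost every `ξ`. -/
theorem lintegral_enorm_sq_fourierFst {F : X × T → ℂ} (hFm : StronglyMeasurable F)
    (hF : Integrable F) (hF2 : MemLp F 2) :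
    ∫⁻ ξ, ∫⁻ t, ‖fourierFst F ξ t‖ₑ ^ 2 = ∫⁻ p, ‖F p‖ₑ ^ 2 := by
  have hm : Measurable fun p : X × T => ‖F p‖ₑ ^ 2 := hFm.measurable.enorm.pow_const 2
  have hFswap : ∫⁻ p, ‖F p‖ₑ ^ 2 = ∫⁻ t, ∫⁻ x, ‖F (x, t)‖ₑ ^ 2 := by
    rw [Measure.volume_eq_prod]
    exact lintegral_prod_symm' _ hm
  have h := lintegral_slices_swap hFm (w := fun _ => 1) measurable_const
  simp only [one_mul] at h
  rw [← h, hFswap]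
  refine lintegral_congr_ae ?_
  filter_upwards [hF.prod_left_ae, ae_memLp_slice hFm hF2] with t h1 h2
  exact lintegral_enorm_sq_fourier h1 h2

theorem ae_memLp_fourierFst {F : X × T → ℂ} (hFm : StronglyMeasurable F)
    (hF : Integrable F) (hF2 : MemLp F 2) : ∀ᵐ ξ : X, MemLp (fourierFst F ξ) 2 := by
  have hm : Measurable fun p : X × T => ‖fourierFst F p.1 p.2‖ₑ ^ 2 :=
    (stronglyMeasurable_fourierFst hFm).measurable.enorm.pow_const 2
  have hfin : ∫⁻ ξ, ∫⁻ t, ‖fourierFst F ξ t‖ₑ ^ 2 < ⊤ := by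
    rw [lintegral_enorm_sq_fourierFst hFm hF hF2, lintegral_enorm_sq_eq_eLpNorm_sq]
    exact ENNReal.pow_lt_top hF2.eLpNorm_lt_top
  filter_upwards [ae_lt_top (Measurable.lintegral_prod_right' hm) hfin.ne] with ξ hξ
  exact memLp_two_of_lintegral_lt_top (integrable_fourierFst hF ξ).aestronglyMeasurable hξ

/-- A weighted Plancherel theorem in the second variable. -/
theorem lintegral_slices_fourier {F : X × T → ℂ} (hFm : StronglyMeasurable F) (hF : Integrable F)
    (hF2 : MemLp F 2) {w : X → ℝ≥0∞} (hw : Measurable w) :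
    ∫⁻ t, ∫⁻ ξ, w ξ * ‖𝓕 (fun x => F (x, t)) ξ‖ₑ ^ 2 =
      ∫⁻ ζ : WithLp 2 (X × T),
        w ζ.fst * ‖𝓕 (fun z : WithLp 2 (X × T) => F (WithLp.ofLp z)) ζ‖ₑ ^ 2 := by
  have hcont : Continuous (𝓕 (fun z : WithLp 2 (X × T) => F (WithLp.ofLp z))) :=
    continuous_fourier (((WithLp.volume_preserving_ofLp X T).integrable_comp_emb
      (MeasurableEquiv.toLp 2 (X × T)).symm.measurableEmbedding).2 hF)
  have hm : Measurable fun ζ : WithLp 2 (X × T) =>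
      w ζ.fst * ‖𝓕 (fun z : WithLp 2 (X × T) => F (WithLp.ofLp z)) ζ‖ₑ ^ 2 :=
    (hw.comp (WithLp.volume_preserving_ofLp X T).measurable.fst).mul
      (hcont.measurable.enorm.pow_const 2)
  -- For fixed `ξ` the weight is constant in `t`, so it factors out and Plancherel in `t` applies.
  have h : ∫⁻ ξ, ∫⁻ t, w ξ * ‖fourierFst F ξ t‖ₑ ^ 2 =
      ∫⁻ ξ, ∫⁻ τ, w ξ * ‖𝓕 (fourierFst F ξ) τ‖ₑ ^ 2 := by
    refine lintegral_congr_ae ?_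
    filter_upwards [ae_memLp_fourierFst hFm hF hF2] with ξ hξ
    have hi := integrable_fourierFst hF ξ
    have hm1 : Measurable fun t => ‖fourierFst F ξ t‖ₑ ^ 2 :=
      ((stronglyMeasurable_fourierFst hFm).measurable.comp
        (measurable_prodMk_left (x := ξ))).enorm.pow_const 2
    have hm2 : Measurable fun τ => ‖𝓕 (fourierFst F ξ) τ‖ₑ ^ 2 :=
      (continuous_fourier hi).measurable.enorm.pow_const 2
    rw [lintegral_const_mul _ hm1, lintegral_const_mul _ hm2, lintegral_enorm_sq_fourier hi hξ]
  refine (lintegral_slices_swap hFm hw).trans (h.trans ?_)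
  rw [← lintegral_lintegral_toLp hm]
  simp only [fourier_toLp_eq_fourier_fourierFst hF, WithLp.toLp_fst]

end Slices
end FracCylinder
namespace FracCylinder
-- Dilation of the second variable and the rescaled energy
section Stretch

variable {n k : ℕ}

/-- `(x, t) ↦ (x, c t)`. -/
def scaleSnd (c : ℝ) (z : Space n k) : Space n k := WithLp.toLp 2 (z.fst, c • z.snd)

theorem continuous_scaleSnd (c : ℝ) : Continuous (scaleSnd (n := n) (k := k) c) := by
  unfold scaleSnd
  fun_prop

theorem scaleSnd_scaleSnd_inv {c : ℝ} (hc : c ≠ 0) (z : Space n k) :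
    scaleSnd c (scaleSnd c⁻¹ z) = z := by
  simp [scaleSnd, smul_smul, hc]
  rfl

theorem scaleSnd_inv_scaleSnd {c : ℝ} (hc : c ≠ 0) (z : Space n k) :
    scaleSnd c⁻¹ (scaleSnd c z) = z := by
  simp [scaleSnd, smul_smul, hc]
  rfl

/-- Self-adjointness transfers a dilation of positions to frequencies. -/
theorem inner_scaleSnd_left (c : ℝ) (z ζ : Space n k) :
    inner ℝ (scaleSnd c z) ζ = inner ℝ z (scaleSnd c ζ) := by
  simp [scaleSnd, WithLp.prod_inner_apply, inner_smul_left, inner_smul_right]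

theorem norm_sq_scaleSnd (c : ℝ) (z : Space n k) :
    ‖scaleSnd c z‖ ^ 2 = ‖z.fst‖ ^ 2 + c ^ 2 * ‖z.snd‖ ^ 2 := by
  rw [WithLp.prod_norm_sq_eq_of_L2]
  simp [scaleSnd, norm_smul, mul_pow]

/-- The symbol inequality behind `E_∞ ≤ E_ℓ`, with no restriction on `c`. -/
theorem norm_fst_le_norm_scaleSnd (c : ℝ) (z : Space n k) : ‖z.fst‖ ≤ ‖scaleSnd c z‖ := by
  refine (sq_le_sq₀ (norm_nonneg _) (norm_nonneg _)).1 ?_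
  rw [norm_sq_scaleSnd]
  nlinarith [mul_nonneg (sq_nonneg c) (sq_nonneg ‖z.snd‖)]

/-- With `c = ℓ⁻¹` and `ℓ ≥ 1`, this supplies the majorant for dominated convergence. -/
theorem norm_scaleSnd_le {c : ℝ} (hc : |c| ≤ 1) (z : Space n k) : ‖scaleSnd c z‖ ≤ ‖z‖ := by
  refine (sq_le_sq₀ (norm_nonneg _) (norm_nonneg _)).1 ?_
  rw [norm_sq_scaleSnd, WithLp.prod_norm_sq_eq_of_L2]
  nlinarith [(sq_le_one_iff_abs_le_one c).2 hc, sq_nonneg ‖z.snd‖]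

/-- `scaleSnd` as a measurable equivalence. -/
noncomputable def scaleSndEquiv {c : ℝ} (hc : c ≠ 0) : Space n k ≃ᵐ Space n k where
  toFun := scaleSnd c
  invFun := scaleSnd c⁻¹
  left_inv := scaleSnd_inv_scaleSnd hc
  right_inv := scaleSnd_scaleSnd_inv hc
  measurable_toFun := (continuous_scaleSnd c).measurable
  measurable_invFun := (continuous_scaleSnd c⁻¹).measurable

theorem map_scaleSnd_volume {c : ℝ} (hc : 0 < c) :
    Measure.map (scaleSnd (n := n) (k := k) c⁻¹) volume = ENNReal.ofReal (c ^ k) • volume := by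
  have h1 := WithLp.volume_preserving_ofLp (EuclideanSpace ℝ (Fin n)) (EuclideanSpace ℝ (Fin k))
  have h2 := WithLp.volume_preserving_toLp (EuclideanSpace ℝ (Fin n)) (EuclideanSpace ℝ (Fin k))
  have hs : scaleSnd (n := n) (k := k) c⁻¹ =
      WithLp.toLp 2 ∘ Prod.map id (c⁻¹ • ·) ∘ WithLp.ofLp := rfl
  have hm : Measurable fun t : EuclideanSpace ℝ (Fin k) => c⁻¹ • t := by fun_prop
  have hmap : Measure.map (fun t : EuclideanSpace ℝ (Fin k) => c⁻¹ • t) volume =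
      ENNReal.ofReal (c ^ k) • volume := by
    rw [Measure.map_addHaar_smul _ (inv_ne_zero hc.ne'), finrank_euclideanSpace_fin, inv_pow,
      inv_inv, abs_of_pos (pow_pos hc k)]
  rw [hs, ← Measure.map_map h2.measurable ((measurable_id.prodMap hm).comp h1.measurable),
    ← Measure.map_map (measurable_id.prodMap hm) h1.measurable, h1.map_eq,
    Measure.volume_eq_prod, ← Measure.map_prod_map _ _ measurable_id hm, hmap, Measure.map_id,
    Measure.prod_smul_right, Measure.map_smul, ← Measure.volume_eq_prod, h2.map_eq]

theorem integral_comp_scaleSnd {c : ℝ} (hc : 0 < c) (f : Space n k → ℂ) :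
    ∫ z, f (scaleSnd c⁻¹ z) = (c : ℂ) ^ k * ∫ z, f z := by
  have h : ∫ z, f (scaleSnd c⁻¹ z) = ∫ y, f y ∂Measure.map (scaleSnd c⁻¹) volume :=
    ((scaleSndEquiv (inv_ne_zero hc.ne')).measurableEmbedding.integral_map f).symm
  rw [h, map_scaleSnd_volume hc, integral_smul_measure, ENNReal.toReal_ofReal (by positivity)]
  simp

theorem lintegral_comp_scaleSnd {c : ℝ} (hc : 0 < c) (f : Space n k → ℝ≥0∞) :
    ∫⁻ z, f (scaleSnd c⁻¹ z) = ENNReal.ofReal (c ^ k) * ∫⁻ z, f z := by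
  have h : ∫⁻ z, f (scaleSnd c⁻¹ z) = ∫⁻ y, f y ∂Measure.map (scaleSnd c⁻¹) volume :=
    ((scaleSndEquiv (inv_ne_zero hc.ne')).measurableEmbedding.lintegral_map f).symm
  rw [h, map_scaleSnd_volume hc, lintegral_smul_measure, smul_eq_mul]

theorem integrable_stretch {c : ℝ} (hc : 0 < c) {u : Space n k → ℝ} (hu : Integrable u) :
    Integrable (stretch c u) := by
  have h : Integrable u (Measure.map (scaleSnd c⁻¹) volume) := by
    rw [map_scaleSnd_volume hc]
    exact hu.smul_measure ENNReal.ofReal_ne_top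
  exact h.comp_measurable (continuous_scaleSnd _).measurable

theorem memLp_stretch {c : ℝ} (hc : 0 < c) {u : Space n k → ℝ} (hu : MemLp u 2) :
    MemLp (stretch c u) 2 := by
  have h : MemLp u 2 (Measure.map (scaleSnd c⁻¹) volume) := by
    rw [map_scaleSnd_volume hc]
    exact hu.smul_measure ENNReal.ofReal_ne_top
  exact h.comp_of_map (continuous_scaleSnd _).aemeasurable

theorem fourier_stretch {c : ℝ} (hc : 0 < c) (u : Space n k → ℝ) (ζ : Space n k) :
    𝓕 (fun z => (stretch c u z : ℂ)) ζ =
      (c : ℂ) ^ k * 𝓕 (fun z => (u z : ℂ)) (scaleSnd c ζ) := by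
  rw [Real.fourier_eq, Real.fourier_eq, ← integral_comp_scaleSnd hc]
  refine integral_congr_ae (.of_forall fun z => ?_)
  simp only [inner_scaleSnd_left, scaleSnd_inv_scaleSnd hc.ne']
  rfl

/-- The energy of a stretched function, on the Fourier side. -/
theorem energy_stretch (s : ℝ) {c : ℝ} (hc : 0 < c) {u : Space n k → ℝ} (hu : Integrable u)
    (hu2 : MemLp u 2) :
    energy s (stretch c u) = ENNReal.ofReal (c ^ k) * ∫⁻ ζ : Space n k,
      ENNReal.ofReal ((2 * Real.pi * ‖scaleSnd c⁻¹ ζ‖) ^ (2 * s)) *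
        ‖𝓕 (fun z => (u z : ℂ)) ζ‖ₑ ^ 2 := by
  have hck : (0 : ℝ) < c ^ k := pow_pos hc k
  rw [energy_eq_lintegral_fourier s (integrable_stretch hc hu) (memLp_stretch hc hu2)]
  set g : Space n k → ℝ≥0∞ := fun ζ => ENNReal.ofReal ((2 * Real.pi * ‖scaleSnd c⁻¹ ζ‖) ^ (2 * s)) *
        ‖𝓕 (fun z => (u z : ℂ)) ζ‖ₑ ^ 2 with hg
  -- The change of variables costs `c⁻ᵏ`, while the squared transform contributes `c²ᵏ`; a single
  -- `cᵏ` survives.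
  have h1 := lintegral_comp_scaleSnd (inv_pos.2 hc) g
  rw [inv_inv] at h1
  have h2 : ∀ ζ : Space n k, ENNReal.ofReal ((2 * Real.pi * ‖ζ‖) ^ (2 * s)) *
      ‖𝓕 (fun z => (stretch c u z : ℂ)) ζ‖ₑ ^ 2 =
        ENNReal.ofReal (c ^ k) ^ 2 * g (scaleSnd c ζ) := by
    intro ζ
    have h3 : ‖(c : ℂ) ^ k‖ₑ = ENNReal.ofReal (c ^ k) := by
      rw [← ofReal_norm, norm_pow, Complex.norm_real, Real.norm_of_nonneg hc.le]
    simp only [hg]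
    rw [fourier_stretch hc, enorm_mul, mul_pow, h3, scaleSnd_inv_scaleSnd hc.ne']
    ring
  simp only [h2]
  rw [lintegral_const_mul' _ _ (by finiteness), h1, ← mul_assoc]
  congr 1
  rw [sq, mul_assoc, ← ENNReal.ofReal_mul hck.le, inv_pow, mul_inv_cancel₀ hck.ne']
  simp

open scoped Pointwise in
theorem rescaledEnergy_eq (s : ℝ) (B : Set (EuclideanSpace ℝ (Fin k))) {c : ℝ} (hc : 0 < c)
    {u : Space n k → ℝ} (hu : Integrable u) (hu2 : MemLp u 2) :
    rescaledEnergy s B c u = (volume B)⁻¹ * ∫⁻ ζ : Space n k,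
      ENNReal.ofReal ((2 * Real.pi * ‖scaleSnd c⁻¹ ζ‖) ^ (2 * s)) *
        ‖𝓕 (fun z => (u z : ℂ)) ζ‖ₑ ^ 2 := by
  have hck : ENNReal.ofReal (c ^ k) ≠ 0 := by
    rw [ENNReal.ofReal_ne_zero_iff]
    positivity
  rw [rescaledEnergy, energy_stretch s hc hu hu2, Measure.addHaar_smul_of_nonneg _ hc.le,
    finrank_euclideanSpace_fin, ENNReal.mul_inv (.inl hck) (.inl ENNReal.ofReal_ne_top),
    ← mul_assoc, mul_right_comm _ (volume B)⁻¹,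
    ENNReal.inv_mul_cancel hck ENNReal.ofReal_ne_top, one_mul]

end Stretch

/-! ### Functions supported in the cylinder and their slice energies -/

section Cylinder

variable {n k : ℕ} {ω : Set (EuclideanSpace ℝ (Fin n))} {B : Set (EuclideanSpace ℝ (Fin k))}

theorem closure_cylinder_subset :
    closure (cylinder ω B) ⊆ {z : Space n k | z.fst ∈ closure ω ∧ z.snd ∈ closure B} := by
  refine closure_minimal (fun z hz => ⟨subset_closure hz.1, subset_closure hz.2⟩) ?_
  have h1 : Continuous fun z : Space n k => z.fst := by fun_prop
  have h2 : Continuous fun z : Space n k => z.snd := by fun_prop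
  exact (isClosed_closure.preimage h1).inter (isClosed_closure.preimage h2)

theorem isBounded_cylinder (hω : Bornology.IsBounded ω) (hB : Bornology.IsBounded B) :
    Bornology.IsBounded (cylinder ω B) := by
  obtain ⟨a, ha⟩ := hω.exists_norm_le
  obtain ⟨b, hb⟩ := hB.exists_norm_le
  refine isBounded_iff_forall_norm_le.2 ⟨a + b, fun z hz => ?_⟩
  have h1 := ha _ hz.1
  have h2 := hb _ hz.2
  have h3 := WithLp.prod_norm_sq_eq_of_L2 z
  have := norm_nonneg z.fst
  have := norm_nonneg z.snd
  refine (sq_le_sq₀ (norm_nonneg _) (by linarith)).1 ?_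
  nlinarith

/-- On a set of finite measure `L²` embeds in `L¹`; boundedness of the domain enters here. -/
theorem Htilde.integrable {V : Type*} [NormedAddCommGroup V] [InnerProductSpace ℝ V]
    [FiniteDimensional ℝ V] [MeasurableSpace V] [BorelSpace V] {s : ℝ} {U : Set V}
    (hU : Bornology.IsBounded U) (u : Htilde s U) : Integrable u.toL2 := by
  have hfin : volume (closure U) < ⊤ := hU.closure.measure_lt_top
  have : IsFiniteMeasure (volume.restrict (closure U)) := ⟨by simpa using hfin⟩
  have h1 : IntegrableOn u.toL2 (closure U) :=
    ((Lp.memLp u.toL2).restrict (closure U)).integrable (by norm_num)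
  exact h1.integrable_of_ae_notMem_eq_zero u.2.2

theorem averagedSliceEnergy_eq (s : ℝ) (hB : IsOpen B) (hBc : Convex ℝ B)
    (hω : Bornology.IsBounded ω) (hB' : Bornology.IsBounded B)
    (u : Htilde s (cylinder ω B)) :
    averagedSliceEnergy s B u.toL2 = (volume B)⁻¹ * ∫⁻ ζ : Space n k,
      ENNReal.ofReal ((2 * Real.pi * ‖ζ.fst‖) ^ (2 * s)) *
        ‖𝓕 (fun z => (u.toL2 z : ℂ)) ζ‖ₑ ^ 2 := by
  have hu := u.integrable (isBounded_cylinder hω hB')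
  have hmp := WithLp.volume_preserving_toLp (EuclideanSpace ℝ (Fin n)) (EuclideanSpace ℝ (Fin k))
  set R : EuclideanSpace ℝ (Fin n) × EuclideanSpace ℝ (Fin k) → ℝ :=
    fun p => u.toL2 (WithLp.toLp 2 p) with hR
  have hRm : StronglyMeasurable R :=
    (Lp.stronglyMeasurable u.toL2).comp_measurable hmp.measurable
  have hR1 : Integrable R := hmp.integrable_comp_of_integrable hu
  have hR2 : MemLp R 2 := (Lp.memLp u.toL2).comp_measurePreserving hmp
  set F : EuclideanSpace ℝ (Fin n) × EuclideanSpace ℝ (Fin k) → ℂ := fun p => (R p : ℂ) with hF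
  have hFm : StronglyMeasurable F := Complex.continuous_ofReal.comp_stronglyMeasurable hRm
  have hF1 : Integrable F := hR1.ofReal
  have hF2 : MemLp F 2 := hR2.ofReal
  have key := lintegral_slices_fourier hFm hF1 hF2
    (w := fun ξ => ENNReal.ofReal ((2 * Real.pi * ‖ξ‖) ^ (2 * s))) (by fun_prop)
  -- The support condition only concerns the closed cylinder. Convexity makes the frontier of `B`
  -- null, so no mass is lost on it.
  have hB0 : B =ᵐ[volume] closure B := by
    refine (ae_eq_set.2 ⟨?_, ?_⟩)
    · simp [sdiff_eq_empty.2 subset_closure]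
    · rw [← hB.frontier_eq]
      exact hBc.addHaar_frontier volume
  have hzero : ∀ᵐ t : EuclideanSpace ℝ (Fin k), t ∉ closure B →
      (fun x => R (x, t)) =ᵐ[volume] 0 := by
    have h1 : ∀ᵐ p : EuclideanSpace ℝ (Fin n) × EuclideanSpace ℝ (Fin k),
        p.2 ∉ closure B → R p = 0 := by
      filter_upwards [hmp.quasiMeasurePreserving.ae u.2.2] with p hp hp2
      exact hp fun h => hp2 (closure_cylinder_subset h).2
    rw [Measure.volume_eq_prod] at h1
    have h2 := Measure.ae_ae_of_ae_prod
      (Measure.measurePreserving_swap.quasiMeasurePreserving.ae h1)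
    filter_upwards [h2] with t ht htB
    filter_upwards [ht] with x hx
    exact hx htB
  -- Almost every slice is in `L¹ ∩ L²`, so the default value `∞` of `energy` plays no role.
  have hslice : ∀ᵐ t : EuclideanSpace ℝ (Fin k), energy s (fun x => R (x, t)) =
      ∫⁻ ξ, ENNReal.ofReal ((2 * Real.pi * ‖ξ‖) ^ (2 * s)) * ‖𝓕 (fun x => F (x, t)) ξ‖ₑ ^ 2 := by
    filter_upwards [hR1.prod_left_ae, ae_memLp_slice hRm hR2] with t h1 h2
    exact energy_eq_lintegral_fourier s h1 h2
  have hcompl : ∫⁻ t in (closure B)ᶜ, ∫⁻ ξ, ENNReal.ofReal ((2 * Real.pi * ‖ξ‖) ^ (2 * s)) *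
      ‖𝓕 (fun x => F (x, t)) ξ‖ₑ ^ 2 = 0 := by
    refine (setLIntegral_congr_fun_ae isClosed_closure.measurableSet.compl
      (g := fun _ => 0) ?_).trans lintegral_zero
    filter_upwards [hzero] with t ht htB
    have h0 : (fun x => F (x, t)) =ᵐ[volume] fun _ => 0 := by
      filter_upwards [ht htB] with x hx
      simp [hF, hx]
    rw [fourier_congr_ae h0]
    simp [Real.fourier_eq]
  have htot := lintegral_add_compl (μ := volume) (fun t : EuclideanSpace ℝ (Fin k) =>
    ∫⁻ ξ : EuclideanSpace ℝ (Fin n), ENNReal.ofReal ((2 * Real.pi * ‖ξ‖) ^ (2 * s)) *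
      ‖𝓕 (fun x => F (x, t)) ξ‖ₑ ^ 2) (isClosed_closure (s := B)).measurableSet
  rw [hcompl, add_zero, key] at htot
  rw [averagedSliceEnergy, setLAverage_eq, ENNReal.div_eq_inv_mul, setLIntegral_congr hB0]
  congr 1
  refine (lintegral_congr_ae (ae_restrict_of_ae hslice)).trans htot

end Cylinder
end FracCylinder
namespace FracCylinder
-- Lower semicontinuity and pointwise convergence of the energies
section Limit

variable {n k : ℕ} {ω : Set (EuclideanSpace ℝ (Fin n))} {B : Set (EuclideanSpace ℝ (Fin k))}
  {s : ℝ} {U : Set (Space n k)}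

/-- The Fourier transform of `(-Δₓ)^{s/2} u`. -/
noncomputable def weightedFst (s : ℝ) (u : Lp ℝ 2 (volume : Measure (Space n k))) (ζ : Space n k) :
    ℂ :=
  (((2 * Real.pi * ‖ζ.fst‖) ^ s : ℝ) : ℂ) * fourierL2 u ζ

theorem weightedFst_add (s : ℝ) (u v : Lp ℝ 2 (volume : Measure (Space n k))) :
    weightedFst s (u + v) =ᵐ[volume] weightedFst s u + weightedFst s v := by
  filter_upwards [Lp.coeFn_add (fourierL2 u) (fourierL2 v)] with ξ h
  simp only [weightedFst, fourierL2_add, h, Pi.add_apply, mul_add]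

theorem weightedFst_smul (s c : ℝ) (u : Lp ℝ 2 (volume : Measure (Space n k))) :
    weightedFst s (c • u) =ᵐ[volume] c • weightedFst s u := by
  filter_upwards [Lp.coeFn_smul (c : ℂ) (fourierL2 u)] with ξ h
  simp only [weightedFst, fourierL2_smul, h, Pi.smul_apply, smul_eq_mul, Complex.real_smul]
  ring

theorem norm_fst_le_norm (z : Space n k) : ‖z.fst‖ ≤ ‖z‖ := by
  refine (sq_le_sq₀ (norm_nonneg _) (norm_nonneg _)).1 ?_
  rw [WithLp.prod_norm_sq_eq_of_L2]
  exact le_add_of_nonneg_right (sq_nonneg _)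

theorem norm_weightedFst_le (hs : 0 ≤ s) (u : Lp ℝ 2 (volume : Measure (Space n k)))
    (ζ : Space n k) : ‖weightedFst s u ζ‖ ≤ ‖weighted s u ζ‖ := by
  have := Real.pi_pos
  rw [weightedFst, weighted, norm_mul, norm_mul, Complex.norm_real, Complex.norm_real,
    Real.norm_of_nonneg (by positivity), Real.norm_of_nonneg (by positivity)]
  gcongr
  exact norm_fst_le_norm ζ

theorem memLp_weightedFst (hs : 0 ≤ s) (u : Htilde s U) :
    MemLp (weightedFst s u.toL2) 2 volume := by
  refine ((memLp_weighted_iff s u.toL2).2 u.2.1).mono ?_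
    (.of_forall (norm_weightedFst_le hs u.toL2))
  refine AEStronglyMeasurable.mul ?_ (Lp.aestronglyMeasurable _)
  have h : Continuous fun ζ : Space n k => ζ.fst := by fun_prop
  have : Measurable fun ζ : Space n k => (((2 * Real.pi * ‖ζ.fst‖) ^ s : ℝ) : ℂ) := by
    have := h.measurable.norm
    fun_prop
  exact this.aestronglyMeasurable

/-- `u ↦ F[(-Δₓ)^{s/2} u]` as a continuous linear map. -/
noncomputable def Htilde.weightedFstCLM (hs : 0 ≤ s) (U : Set (Space n k)) :
    Htilde s U →L[ℝ] Lp ℂ 2 (volume : Measure (Space n k)) :=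
  LinearMap.mkContinuous
    { toFun u := (memLp_weightedFst hs u).toLp _
      map_add' u v := by
        rw [← MemLp.toLp_add]
        exact MemLp.toLp_congr _ _ (weightedFst_add s u.toL2 v.toL2)
      map_smul' c u := by
        rw [RingHom.id_apply, ← MemLp.toLp_const_smul]
        exact MemLp.toLp_congr _ _ (weightedFst_smul s c u.toL2) } 1 (fun u => by
    have h1 : ‖(memLp_weightedFst hs u).toLp _‖ ≤
        ‖((memLp_weighted_iff s u.toL2).2 u.2.1).toLp _‖ := by
      rw [Lp.norm_toLp, Lp.norm_toLp]
      exact ENNReal.toReal_mono ((memLp_weighted_iff s u.toL2).2 u.2.1).eLpNorm_ne_top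
        (eLpNorm_mono (norm_weightedFst_le hs u.toL2))
    have h2 := Htilde.norm_sq u
    rw [energyL2_eq, ENNReal.toReal_pow,
      ← Lp.norm_toLp _ ((memLp_weighted_iff s u.toL2).2 u.2.1)] at h2
    rw [one_mul]
    refine h1.trans ((sq_le_sq₀ (norm_nonneg _) (norm_nonneg _)).1 ?_)
    rw [h2]
    exact le_add_of_nonneg_right (sq_nonneg _))

theorem fourierL2_toL2_ae_eq (hU : Bornology.IsBounded U) (u : Htilde s U) :
    fourierL2 u.toL2 =ᵐ[volume] 𝓕 (fun z => (u.toL2 z : ℂ)) :=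
  fourierL2_ae_eq _ (u.integrable hU)

theorem ofReal_norm_sq_weightedFstCLM (hs : 0 ≤ s) (hU : Bornology.IsBounded U)
    (u : Htilde s U) :
    ENNReal.ofReal (‖Htilde.weightedFstCLM hs U u‖ ^ 2) = ∫⁻ ζ : Space n k,
      ENNReal.ofReal ((2 * Real.pi * ‖ζ.fst‖) ^ (2 * s)) *
        ‖𝓕 (fun z => (u.toL2 z : ℂ)) ζ‖ₑ ^ 2 := by
  change ENNReal.ofReal (‖(memLp_weightedFst hs u).toLp _‖ ^ 2) = _
  rw [ENNReal.ofReal_pow (norm_nonneg _), ofReal_norm, Lp.enorm_toLp,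
    ← lintegral_enorm_sq_eq_eLpNorm_sq]
  refine lintegral_congr_ae ?_
  filter_upwards [fourierL2_toL2_ae_eq hU u] with ζ hζ
  have h0 : 0 ≤ 2 * Real.pi * ‖ζ.fst‖ := by positivity
  rw [weightedFst, enorm_mul, mul_pow, hζ, ← ofReal_norm, Complex.norm_real,
    Real.norm_of_nonneg (Real.rpow_nonneg h0 _), ← ENNReal.ofReal_pow (Real.rpow_nonneg h0 _),
    ← Real.rpow_mul_natCast h0]
  congr 3
  push_cast
  ring

theorem averagedSliceEnergy_eq_norm_sq (hs : 0 ≤ s) (hB : IsOpen B) (hBc : Convex ℝ B)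
    (hω : Bornology.IsBounded ω) (hB' : Bornology.IsBounded B) (u : Htilde s (cylinder ω B)) :
    averagedSliceEnergy s B u.toL2 =
      (volume B)⁻¹ * ENNReal.ofReal (‖Htilde.weightedFstCLM hs (cylinder ω B) u‖ ^ 2) := by
  rw [averagedSliceEnergy_eq s hB hBc hω hB', ofReal_norm_sq_weightedFstCLM hs
    (isBounded_cylinder hω hB')]

theorem averagedSliceEnergy_le_rescaledEnergy (hs : 0 ≤ s) (hB : IsOpen B) (hBc : Convex ℝ B)
    (hω : Bornology.IsBounded ω) (hB' : Bornology.IsBounded B) {c : ℝ} (hc : 0 < c)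
    (u : Htilde s (cylinder ω B)) :
    averagedSliceEnergy s B u.toL2 ≤ rescaledEnergy s B c u.toL2 := by
  rw [averagedSliceEnergy_eq s hB hBc hω hB',
    rescaledEnergy_eq s B hc (u.integrable (isBounded_cylinder hω hB')) (Lp.memLp _)]
  gcongr with ζ
  exact norm_fst_le_norm_scaleSnd c⁻¹ ζ

theorem tendsto_rescaledEnergy (hs : 0 ≤ s) (hB : IsOpen B) (hBc : Convex ℝ B)
    (hBne : B.Nonempty) (hω : Bornology.IsBounded ω) (hB' : Bornology.IsBounded B)
    {ℓ : ℕ → ℝ} (hℓ : ∀ h, 0 < ℓ h) (hℓ' : Tendsto ℓ atTop atTop)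
    (u : Htilde s (cylinder ω B)) :
    Tendsto (fun h => rescaledEnergy s B (ℓ h) u.toL2) atTop
      (𝓝 (averagedSliceEnergy s B u.toL2)) := by
  have hU := isBounded_cylinder hω hB'
  have hint := u.integrable hU
  have hFm : Measurable fun ζ => ‖𝓕 (fun z => (u.toL2 z : ℂ)) ζ‖ₑ ^ 2 :=
    (continuous_fourier hint.ofReal).measurable.enorm.pow_const 2
  rw [averagedSliceEnergy_eq s hB hBc hω hB']
  simp only [fun h => rescaledEnergy_eq s B (hℓ h) hint (Lp.memLp u.toL2)]
  -- The factor `|B|⁻¹` must be finite: a nonempty open set has positive volume.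
  refine ENNReal.Tendsto.const_mul ?_
    (.inr (ENNReal.inv_ne_top.2 (hB.measure_pos volume hBne).ne'))
  have hinv : Tendsto (fun h => (ℓ h)⁻¹) atTop (𝓝 0) := tendsto_inv_atTop_zero.comp hℓ'
  refine tendsto_lintegral_filter_of_dominated_convergence
    (fun ζ => ENNReal.ofReal ((2 * Real.pi * ‖ζ‖) ^ (2 * s)) *
        ‖𝓕 (fun z => (u.toL2 z : ℂ)) ζ‖ₑ ^ 2) ?_ ?_ ?_ ?_
  · refine .of_forall fun h => Measurable.mul ?_ hFm
    have := (continuous_scaleSnd (n := n) (k := k) (ℓ h)⁻¹).measurable.norm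
    fun_prop
  · filter_upwards [hℓ'.eventually_ge_atTop 1] with h hh
    refine .of_forall fun ζ => ?_
    gcongr
    refine norm_scaleSnd_le ?_ ζ
    rw [abs_of_pos (inv_pos.2 (hℓ h))]
    exact inv_le_one_of_one_le₀ hh
  -- The integral of the majorant is the full energy of `u`, finite by membership in `H̃ˢ`.
  · have h1 : energyL2 s u.toL2 = ∫⁻ ζ : Space n k,
        ENNReal.ofReal ((2 * Real.pi * ‖ζ‖) ^ (2 * s)) *
          ‖𝓕 (fun z => (u.toL2 z : ℂ)) ζ‖ₑ ^ 2 := by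
      refine lintegral_congr_ae ?_
      filter_upwards [fourierL2_toL2_ae_eq hU u] with ζ hζ
      rw [hζ]
    rw [← h1]
    exact u.2.1.ne
  · refine .of_forall fun ζ => ENNReal.Tendsto.mul_const ?_ (.inr (by finiteness))
    refine ENNReal.tendsto_ofReal ?_
    -- The exponent is nonnegative, so the power stays continuous even where the base vanishes.
    have h2 : Continuous fun c : ℝ => (2 * Real.pi * ‖scaleSnd c ζ‖) ^ (2 * s) := by
      have h3 : Continuous fun c : ℝ => scaleSnd c ζ := by
        unfold scaleSnd
        fun_prop
      exact (continuous_const.mul h3.norm).rpow_const fun _ => .inr (by positivity)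
    have h4 : ‖scaleSnd 0 ζ‖ = ‖ζ.fst‖ := by
      refine (sq_eq_sq₀ (norm_nonneg _) (norm_nonneg _)).1 ?_
      rw [norm_sq_scaleSnd]
      ring
    have h5 := (h2.tendsto 0).comp hinv
    simpa only [h4, Function.comp_def] using h5

/-- With `y = Tv`, the weakly continuous affine function `u ↦ 2 Re⟨y, Tu⟩ - ‖y‖²` lies below `‖Tu‖²`
and touches it at `v`. -/
theorem averagedSliceEnergy_le_liminf (hs : 0 ≤ s) (hB : IsOpen B) (hBc : Convex ℝ B)
    (hBne : B.Nonempty) (hω : Bornology.IsBounded ω) (hB' : Bornology.IsBounded B)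
    {ι : Type*} {l : Filter ι} [l.NeBot] {w : ι → WeakSpace ℝ (Htilde s (cylinder ω B))}
    {v : WeakSpace ℝ (Htilde s (cylinder ω B))} (hw : Tendsto w l (𝓝 v)) :
    averagedSliceEnergy s B ((toWeakSpace ℝ _).symm v).toL2 ≤
      liminf (fun h => averagedSliceEnergy s B ((toWeakSpace ℝ _).symm (w h)).toL2) l := by
  simp only [averagedSliceEnergy_eq_norm_sq hs hB hBc hω hB']
  set T := Htilde.weightedFstCLM hs (cylinder ω B)
  set y := T ((toWeakSpace ℝ _).symm v)
  -- The target of `T` is complex but `H̃ˢ` is real, so the real part of the pairing with `y` gives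
  -- the functional.
  set φ : StrongDual ℝ (Htilde s (cylinder ω B)) :=
    Complex.reCLM ∘L ((innerSL ℂ y).restrictScalars ℝ) ∘L T
  have hφ : Tendsto (fun h => φ ((toWeakSpace ℝ _).symm (w h))) l
      (𝓝 (φ ((toWeakSpace ℝ _).symm v))) :=
    ((WeakBilin.eval_continuous (topDualPairing ℝ (Htilde s (cylinder ω B))).flip φ).tendsto v).comp
      hw
  have hval : φ ((toWeakSpace ℝ _).symm v) = ‖y‖ ^ 2 := inner_self_eq_norm_sq (𝕜 := ℂ) y
  have hle (u : Htilde s (cylinder ω B)) : 2 * φ u - ‖y‖ ^ 2 ≤ ‖T u‖ ^ 2 := by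
    have h1 : ‖y - T u‖ ^ 2 = ‖y‖ ^ 2 - 2 * φ u + ‖T u‖ ^ 2 := norm_sub_sq (𝕜 := ℂ) y (T u)
    nlinarith [sq_nonneg ‖y - T u‖]
  -- The affine minorant may be negative; truncation at `0` by `ENNReal.ofReal` is monotone and
  -- keeps the inequality.
  have hlim : Tendsto (fun h => (volume B)⁻¹ *
      ENNReal.ofReal (2 * φ ((toWeakSpace ℝ _).symm (w h)) - ‖y‖ ^ 2)) l
      (𝓝 ((volume B)⁻¹ * ENNReal.ofReal (‖y‖ ^ 2))) := by
    refine ENNReal.Tendsto.const_mul (ENNReal.tendsto_ofReal ?_)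
      (.inr (ENNReal.inv_ne_top.2 (hB.measure_pos volume hBne).ne'))
    have := (hφ.const_mul 2).sub_const (‖y‖ ^ 2)
    rw [hval] at this
    convert this using 2
    ring
  rw [← hlim.liminf_eq]
  refine liminf_le_liminf (.of_forall fun h => ?_)
  gcongr
  exact hle _

end Limit
end FracCylinder

theorem theorem4 (n k : ℕ) (hn : 1 ≤ n) (hk : 1 ≤ k) (s : ℝ) (hs : 0 < s) (hs' : s < 1)
    (ω : Set (EuclideanSpace ℝ (Fin n))) (hω : IsOpen ω) (hω' : Bornology.IsBounded ω)
    (B : Set (EuclideanSpace ℝ (Fin k))) (hB : IsOpen B) (hB' : Bornology.IsBounded B)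
    (hBc : Convex ℝ B) (hB0 : (0 : EuclideanSpace ℝ (Fin k)) ∈ B)
    (ℓ : ℕ → ℝ) (hℓ : ∀ h, 0 < ℓ h) (hℓ' : Tendsto ℓ atTop atTop) :
    FracCylinder.IsGammaLimit
      (X := WeakSpace ℝ (FracCylinder.Htilde s (FracCylinder.cylinder ω B)))
      (fun h v => ((FracCylinder.rescaledEnergy s B (ℓ h)
        ((toWeakSpace ℝ (FracCylinder.Htilde s (FracCylinder.cylinder ω B))).symm v).toL2 :
          ℝ≥0∞) : EReal))
      (fun v => ((FracCylinder.averagedSliceEnergy s B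
        ((toWeakSpace ℝ (FracCylinder.Htilde s (FracCylinder.cylinder ω B))).symm v).toL2 :
          ℝ≥0∞) : EReal)) := by

  have hBne : B.Nonempty := ⟨0, hB0⟩
  have hcont : Continuous ((↑) : ℝ≥0∞ → EReal) := continuous_coe_ennreal_ereal
  have hmono : Monotone ((↑) : ℝ≥0∞ → EReal) := fun _ _ h => EReal.coe_ennreal_le_coe_ennreal_iff.2 h
  refine ⟨fun v w hw => ?_, fun v => ⟨fun _ => v, tendsto_const_nhds, ?_⟩⟩
  · have h1 := FracCylinder.averagedSliceEnergy_le_liminf hs.le hB hBc hBne hω' hB' hw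
    have h2 := h1.trans (liminf_le_liminf (.of_forall fun h =>
      FracCylinder.averagedSliceEnergy_le_rescaledEnergy hs.le hB hBc hω' hB' (hℓ h)
        ((toWeakSpace ℝ _).symm (w h))))
    -- The coercion to `EReal` is monotone and continuous, hence commutes with `liminf`.
    exact (hmono h2).trans (hmono.map_liminf_of_continuousAt _ hcont.continuousAt).le
  · exact ((hcont.tendsto _).comp (FracCylinder.tendsto_rescaledEnergy hs.le hB hBc hBne hω' hB'
      hℓ hℓ' ((toWeakSpace ℝ _).symm v))).limsup_eq.le
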